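/- An overpartition of a nonnegative integer $n$ is a partition of $n$ in which the first occurrence of each part size may be overlined or not. Let $\chi$ be the characteristic function of the primes ($\chi(m)=1$ if $m$ is prime, $\chi(m)=0$ otherwise), let $S(m,n)$ be the number of non-overlined parts equal to $m$ in all the overpartitions of $n$, and let $$A(\chi,1,0;n)=\sum_{m\ge 1} S(m,n)\,\chi(m),$$ that is, the number of prime non-overlined parts in all the overpartitions of $n$; put $A(\chi,1,0;n)=0$ for $n<0$. Let $\omega(n)$ be the number of distinct primes dividing $n$, and let $\overline{M}_k(n)$ be the number of overpartitions of $n$ that have a part larger than $k$ and in which the smallest part larger than $k$ appears at least $k+1$ times (a possible overlined copy included). Then for all integers $k,n>0$, $$(-1)^k\left(A(\chi,1,0;n)+2\sum_{j=1}^{k}(-1)^jA\big(\chi,1,0;n-j^2\big)-\omega(n)\right)=\sum_{j=2}^{n}\omega(j)\,\overline{M}_k(n-j).$$ -/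

import Mathlib

/-- An overpartition of `n`: a partition of `n` together with the set of those part sizes whose
first occurrence is overlined. -/
structure Overpartition (n : ℕ) where
  /-- the underlying partition, overlines forgotten -/
  toPartition : Nat.Partition n
  /-- the part sizes whose first occurrence is overlined -/
  overlined : Finset ℕ
  overlined_subset : overlined ⊆ toPartition.parts.toFinset

namespace Overpartition

/-- Overpartitions of `n` as pairs (partition, subset of its set of part sizes). -/
def equivSigma (n : ℕ) :
    ((p : Nat.Partition n) × {s : Finset ℕ // s ∈ p.parts.toFinset.powerset}) ≃
      Overpartition n where
  toFun x := ⟨x.1, x.2.1, Finset.mem_powerset.1 x.2.2⟩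
  invFun π := ⟨π.toPartition, π.overlined, Finset.mem_powerset.2 π.overlined_subset⟩
  left_inv _ := rfl
  right_inv _ := rfl

instance (n : ℕ) : Fintype (Overpartition n) := Fintype.ofEquiv _ (equivSigma n)

/-- All parts, overlined or not, with multiplicity. -/
def parts {n : ℕ} (π : Overpartition n) : Multiset ℕ := π.toPartition.parts

/-- The non-overlined parts, with multiplicity: one copy of each overlined size is removed. -/
def nonOverlined {n : ℕ} (π : Overpartition n) : Multiset ℕ := π.parts - π.overlined.val

/-- `S k n`: the number of non-overlined parts equal to `k` in all the overpartitions of `n`. -/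
def S (k n : ℕ) : ℕ := ∑ π : Overpartition n, π.nonOverlined.count k

/-- `A a α β n = ∑_{k ≥ 1} S (α k - β) n * a k` for `0 ≤ β < α`, a sum with finitely many nonzero
terms; it is `0` for negative `n`, since a negative integer has no overpartitions. -/
noncomputable def A (a : ℕ → ℂ) (α β : ℕ) (n : ℤ) : ℂ :=
  if 0 ≤ n then ∑' k : ℕ, (S (α * (k + 1) - β) n.toNat : ℂ) * a (k + 1) else 0

/-- The characteristic function of the primes. -/
noncomputable def chi (n : ℕ) : ℂ := if n.Prime then 1 else 0

/-- `M k n`: the number of overpartitions of `n` in which the first (that is, the smallest) part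
larger than `k` exists and appears at least `k + 1` times, its overlined copy included. -/
def M (k n : ℕ) : ℕ :=
  (Finset.univ.filter fun π : Overpartition n =>
    ∃ m ∈ π.parts.toFinset, k < m ∧ (∀ i ∈ π.parts.toFinset, k < i → m ≤ i) ∧ k + 1 ≤ π.parts.count m).card

theorem S_eq_zero {k n : ℕ} (h : n < k) : S k n = 0 := by
  refine Finset.sum_eq_zero fun π _ => Multiset.count_eq_zero.2 fun hk => ?_
  have := π.toPartition.le_of_mem_parts (Multiset.mem_of_le (Multiset.sub_le_self _ _) hk)
  omega

/-- `A chi 1 0 n` is the number of prime non-overlined parts in all the overpartitions of `n`. -/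
theorem A_chi_eq (n : ℕ) :
    A chi 1 0 n = ((∑ π : Overpartition n, (π.nonOverlined.filter Nat.Prime).card : ℕ) : ℂ) := by
  have h1 : A chi 1 0 n = ∑ k ∈ Finset.range n, (S (k + 1) n : ℂ) * chi (k + 1) := by
    have h0 : (0 : ℤ) ≤ n := by positivity
    simp only [A, if_pos h0, Int.toNat_natCast, one_mul, Nat.sub_zero]
    refine tsum_eq_sum fun k hk => ?_
    rw [S_eq_zero (by simpa [Nat.lt_succ_iff] using hk)]
    simp
  have h2 : ∀ π : Overpartition n, (π.nonOverlined.filter Nat.Prime).card =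
      ∑ k ∈ Finset.range n, if (k + 1).Prime then π.nonOverlined.count (k + 1) else 0 := by
    intro π
    have hs : ∀ x ∈ π.nonOverlined.filter Nat.Prime, x ∈ Finset.range (n + 1) := by
      intro x hx
      have := π.toPartition.le_of_mem_parts
        (Multiset.mem_of_le (Multiset.sub_le_self _ _) (Multiset.mem_filter.1 hx).1)
      simpa [Nat.lt_succ_iff] using this
    rw [← Multiset.sum_count_eq_card hs, Finset.sum_range_succ']
    simp [Multiset.count_filter, Nat.not_prime_zero]
  rw [h1, Finset.sum_congr rfl fun π _ => h2 π, Finset.sum_comm]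
  push_cast
  refine Finset.sum_congr rfl fun k _ => ?_
  by_cases hp : (k + 1).Prime <;> simp [chi, hp, S]

end Overpartition

/-! Let `P = ∏ (1 + q^i) / (1 - q^i)` be the generating function of overpartitions. The
non-overlined parts `m` are generated by `q^m / (1 - q^m) * P`, so the prime ones are generated by
`L * P`, where `L = ∑_p q^p / (1 - q^p) = ∑ ω(n) q^n`. The theorem is then `L` times the truncated
Gauss identity `P * (1 + 2 ∑_{j ≤ k} (-1)^j q^(j^2)) = 1 + (-1)^k ∑ M_k(n) q^n`.

That identity (`series_mul_truncated_theta`) goes by induction on `k`: its case `k = 0` classifies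
nonempty overpartitions by smallest part, and the step is `M_(k+1) + M_k = 2 q^((k+1)^2) P` on
generating functions (`MSeries_succ_add`), a telescoping sum over the distinguished part.

Infinite products are avoided: parts are bounded by `N`, which leaves coefficients up to `N`
unchanged and costs an error divisible by `X^(N+1)`. -/

namespace Overpartition

open Finset PowerSeries

/-! ### Generating functions of weighted partitions -/

/-- The power series `∑ u c * X ^ (i * c)` recording the contribution of the part size `i`, when
`c` occurrences have weight `u c`. -/
noncomputable def partSeries (u : ℕ → ℂ) (i : ℕ) : PowerSeries ℂ :=
  PowerSeries.mk fun e => if i ∣ e then u (e / i) else 0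

/-- Splitting off multiplicity zero gives a recursion that replaces division by `1 - X ^ i` in all
later closed forms. -/
theorem partSeries_eq (u : ℕ → ℂ) {i : ℕ} (hi : 0 < i) :
    partSeries u i = C (u 0) + X ^ i * partSeries (fun c => u (c + 1)) i := by
  ext e
  rw [map_add, coeff_X_pow_mul', partSeries, coeff_mk, coeff_C, partSeries, coeff_mk]
  rcases Nat.eq_zero_or_pos e with rfl | he
  · simp [hi.ne']
  · by_cases hie : i ≤ e
    · obtain ⟨d, rfl⟩ := Nat.exists_eq_add_of_le hie
      simp [hi.ne', hi, Nat.add_div_left]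
    · have : ¬ i ∣ e := fun h => hie (Nat.le_of_dvd he h)
      simp [hie, this, he.ne']

theorem sum_partition_prod_eq_coeff (w : ℕ → ℕ → ℂ) {n N : ℕ} (hn : n ≤ N) :
    ∑ p : Nat.Partition n, ∏ i ∈ Ioc 0 N, w i (p.parts.count i) =
      coeff n (∏ i ∈ Ioc 0 N, partSeries (w i) i) := by
  rw [coeff_prod]
  refine sum_of_injOn Nat.Partition.toFinsuppAntidiag
    (Nat.Partition.toFinsuppAntidiag_injective n).injOn ?_ ?_ ?_
  · intro p _
    refine finsuppAntidiag_mono (fun i hi => ?_) _ p.toFinsuppAntidiag_mem_finsuppAntidiag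
    rw [mem_Icc] at hi
    rw [mem_Ioc]
    omega
  -- The image of the partitions is the set of `g` with `i ∣ g i` for all `i`; any other `g` has a
  -- zero factor.
  · intro g hg hg'
    contrapose! hg'
    obtain ⟨hsum, hsupp⟩ := mem_finsuppAntidiag.mp hg
    have hpos : ∀ i, g i ≠ 0 → 0 < i := fun i hi =>
      (mem_Ioc.1 (hsupp (Finsupp.mem_support_iff.2 hi))).1
    have hdvd : ∀ i, i ∣ g i := by
      intro i
      by_cases hi : i ∈ Ioc 0 N
      · have h0 := prod_ne_zero_iff.1 hg' i hi
        rw [partSeries, coeff_mk] at h0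
        by_contra h
        exact h0 (if_neg h)
      · have : g i = 0 := by
          by_contra h
          exact hi (hsupp (Finsupp.mem_support_iff.2 h))
        simp [this]
    refine ⟨⟨(Finsupp.mk g.support (fun i => g i / i) ?_).toMultiset, ?_, ?_⟩, by simp, ?_⟩
    · intro i
      rw [Finsupp.mem_support_iff]
      refine ⟨fun h => ?_, fun h h' => h (by simp [h'])⟩
      exact (Nat.div_pos (Nat.le_of_dvd (Nat.pos_of_ne_zero h) (hdvd i)) (hpos i h)).ne'
    · intro i hi
      rw [Finsupp.mem_toMultiset, Finsupp.mem_support_iff] at hi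
      exact hpos i fun h => hi (by simp [h])
    · refine Eq.trans ?_ hsum
      rw [Finsupp.sum_toMultiset]
      simp only [Finsupp.sum, Finsupp.coe_mk, smul_eq_mul]
      refine sum_subset_zero_on_sdiff hsupp (fun i hi => ?_) fun i _ =>
        Nat.div_mul_cancel (hdvd i)
      simpa using (mem_sdiff.1 hi).2
    · ext i
      simpa [Nat.Partition.toFinsuppAntidiag] using Nat.div_mul_cancel (hdvd i)
  · intro p _
    refine prod_congr rfl fun i hi => ?_
    have hi0 : 0 < i := (mem_Ioc.1 hi).1
    simp [partSeries, Nat.Partition.toFinsuppAntidiag, hi0]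

/-! ### The factors of the generating functions -/

/-- The geometric series in `X ^ i`. -/
noncomputable def geom (i : ℕ) : PowerSeries ℂ := partSeries 1 i

/-- The number of ways of overlining `c` copies of a part size. -/
def overWeight (c : ℕ) : ℂ := if c = 0 then 1 else 2

/-- The factor `(1 + X ^ i) / (1 - X ^ i)` of the generating function of overpartitions. -/
noncomputable def factor (i : ℕ) : PowerSeries ℂ := partSeries overWeight i

theorem geom_eq {i : ℕ} (hi : 0 < i) : geom i = 1 + X ^ i * geom i := by
  conv_lhs => rw [geom, partSeries_eq _ hi]
  simp only [Pi.one_apply, map_one]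
  rfl

theorem partSeries_const (a : ℂ) (i : ℕ) : partSeries (fun _ => a) i = C a * geom i := by
  ext e
  simp [geom, partSeries]

theorem C_two : (C (2 : ℂ) : PowerSeries ℂ) = 2 := map_ofNat C 2

theorem factor_eq_geom {i : ℕ} (hi : 0 < i) : factor i = (1 + X ^ i) * geom i := by
  have h : factor i = 1 + X ^ i * (2 * geom i) := by
    rw [factor, partSeries_eq _ hi]
    simp [overWeight, partSeries_const, C_two]
  rw [h]
  linear_combination -geom_eq hi

theorem partSeries_ite_eq_zero {i : ℕ} (hi : 0 < i) :
    partSeries (fun c => if c = 0 then overWeight c else 0) i = 1 := by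
  rw [partSeries_eq _ hi]
  simp [overWeight, partSeries_const]

theorem partSeries_ite_le {i : ℕ} (hi : 0 < i) (k : ℕ) :
    partSeries (fun c => if k + 1 ≤ c then overWeight c else 0) i =
      2 * X ^ (i * (k + 1)) * geom i := by
  have h : ∀ k : ℕ, partSeries (fun c => if k ≤ c then (2 : ℂ) else 0) i =
      2 * X ^ (i * k) * geom i := by
    intro k
    induction k with
    | zero => simp [partSeries_const, C_two]
    | succ k ih =>
      rw [partSeries_eq _ hi]
      simp only [add_le_add_iff_right, ih]
      simp
      ring
  rw [← h]
  congr 1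
  ext c
  by_cases hc : k + 1 ≤ c
  · simp [hc, overWeight, show c ≠ 0 by omega]
  · simp [hc]

theorem partSeries_add (u v : ℕ → ℂ) (i : ℕ) :
    partSeries (fun c => u c + v c) i = partSeries u i + partSeries v i := by
  ext e
  by_cases h : i ∣ e <;> simp [partSeries, h]

/-- The number of non-overlined copies of a part size occurring `c` times, summed over the ways of
overlining it. -/
def nonOverWeight (c : ℕ) : ℂ := if c = 0 then 0 else 2 * c - 1

/-- With `x = X ^ i`, this is `∑ (2c - 1) x^c = x (1 + x) / (1 - x)^2`. -/
theorem partSeries_nonOverWeight {i : ℕ} (hi : 0 < i) :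
    partSeries nonOverWeight i = X ^ i * geom i * factor i := by
  have h1 : partSeries nonOverWeight i = X ^ i * partSeries (fun c => 2 * (c : ℂ) + 1) i := by
    rw [partSeries_eq _ hi]
    have : (fun c : ℕ => nonOverWeight (c + 1)) = fun c : ℕ => 2 * (c : ℂ) + 1 := by
      ext c
      simp [nonOverWeight]
      ring
    rw [this]
    simp [nonOverWeight]
  have h2 : partSeries (fun c => 2 * (c : ℂ) + 1) i =
      1 + X ^ i * (partSeries (fun c => 2 * (c : ℂ) + 1) i + 2 * geom i) := by
    conv_lhs => rw [partSeries_eq _ hi]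
    have : (fun c : ℕ => 2 * ((c + 1 : ℕ) : ℂ) + 1) = fun c : ℕ => (2 * (c : ℂ) + 1) + 2 := by
      ext c
      push_cast
      ring
    rw [this, partSeries_add, partSeries_const, C_two]
    simp
  rw [h1, factor_eq_geom hi]
  set V := partSeries (fun c => 2 * (c : ℂ) + 1) i
  have hg := geom_eq hi
  linear_combination (X ^ i * geom i) * h2 + (-X ^ i * geom i - X ^ i * V) * hg

/-! ### Sums over overpartitions -/

theorem sum_eq_sum_partition {n : ℕ} (f : Nat.Partition n → Finset ℕ → ℂ) :
    ∑ π : Overpartition n, f π.toPartition π.overlined =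
      ∑ p : Nat.Partition n, ∑ s ∈ p.parts.toFinset.powerset, f p s := by
  rw [← Equiv.sum_comp (equivSigma n), Fintype.sum_sigma]
  refine sum_congr rfl fun p _ => ?_
  exact sum_coe_sort p.parts.toFinset.powerset (fun s => f p s)

theorem prod_overWeight {n N : ℕ} (hn : n ≤ N) (p : Nat.Partition n) :
    ∏ i ∈ Ioc 0 N, overWeight (p.parts.count i) = 2 ^ p.parts.toFinset.card := by
  have hs : p.parts.toFinset ⊆ Ioc 0 N := by
    intro i hi
    rw [Multiset.mem_toFinset] at hi
    exact mem_Ioc.2 ⟨p.parts_pos hi, (p.le_of_mem_parts hi).trans hn⟩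
  rw [← prod_const]
  refine (prod_subset_one_on_sdiff hs (fun i hi => ?_) fun i hi => ?_).symm
  · have : i ∉ p.parts := by simpa using (mem_sdiff.1 hi).2
    simp [overWeight, Multiset.count_eq_zero.2 this]
  · rw [Multiset.mem_toFinset] at hi
    simp [overWeight, hi]

/-- If `m` occurs `c > 0` times, pairing `s` with `insert m s` contributes `c + (c - 1)`; every
other size present is overlined or not, freely, giving a factor 2. -/
theorem sum_count_nonOverlined {n N m : ℕ} (hn : n ≤ N) (hm : m ∈ Ioc 0 N)
    (p : Nat.Partition n) :
    ∑ s ∈ p.parts.toFinset.powerset, (((p.parts - s.val).count m : ℕ) : ℂ) =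
      ∏ i ∈ Ioc 0 N, (if i = m then nonOverWeight else overWeight) (p.parts.count i) := by
  have hP := prod_overWeight hn p
  rw [← mul_prod_erase _ _ hm] at hP ⊢
  have hE : ∏ i ∈ (Ioc 0 N).erase m,
      (if i = m then nonOverWeight else overWeight) (p.parts.count i) =
      ∏ i ∈ (Ioc 0 N).erase m, overWeight (p.parts.count i) :=
    prod_congr rfl fun i hi => by rw [if_neg (ne_of_mem_erase hi)]
  rw [hE, if_pos rfl]
  by_cases hmp : m ∈ p.parts
  · have hc : 1 ≤ p.parts.count m := Multiset.one_le_count_iff_mem.2 hmp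
    have hT : m ∈ p.parts.toFinset := Multiset.mem_toFinset.2 hmp
    have hcard := card_erase_add_one hT
    rw [← hcard, overWeight, if_neg (by omega), pow_succ, mul_comm] at hP
    rw [mul_right_cancel₀ two_ne_zero hP, ← insert_erase hT,
      sum_powerset_insert (notMem_erase m _), insert_erase hT, ← sum_add_distrib]
    have h : ∀ s ∈ (p.parts.toFinset.erase m).powerset,
        (((p.parts - s.val).count m : ℕ) : ℂ) +
          (((p.parts - (insert m s).val).count m : ℕ) : ℂ) = nonOverWeight (p.parts.count m) := by
      intro s hs
      have hms : m ∉ s := fun h => notMem_erase m _ (mem_powerset.1 hs h)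
      rw [Multiset.count_sub, Multiset.count_sub, Multiset.count_eq_zero.2 (show m ∉ s.val from hms),
        Multiset.count_eq_one_of_mem (insert m s).nodup (by simp), nonOverWeight,
        if_neg (by omega), Nat.cast_sub hc]
      simp
      ring
    rw [sum_congr rfl h, sum_const, card_powerset]
    simp [mul_comm]
  · have h0 : p.parts.count m = 0 := Multiset.count_eq_zero.2 hmp
    simp [h0, Multiset.count_sub, nonOverWeight]

/-- The generating function of overpartitions with parts at most `N`. -/
noncomputable def series (N : ℕ) : PowerSeries ℂ := ∏ i ∈ Ioc 0 N, factor i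

theorem S_eq_coeff {n N m : ℕ} (hn : n ≤ N) (hm : m ∈ Ioc 0 N) :
    (S m n : ℂ) = coeff n (X ^ m * geom m * series N) := by
  have h1 : (S m n : ℂ) =
      ∑ π : Overpartition n, (((π.toPartition.parts - π.overlined.val).count m : ℕ) : ℂ) := by
    simp [S, nonOverlined, parts]
  rw [h1, sum_eq_sum_partition fun p s => (((p.parts - s.val).count m : ℕ) : ℂ),
    sum_congr rfl fun p _ => sum_count_nonOverlined hn hm p,
    sum_partition_prod_eq_coeff (fun i => if i = m then nonOverWeight else overWeight) hn]
  congr 1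
  rw [series, ← mul_prod_erase _ _ hm, ← mul_prod_erase _ factor hm, if_pos rfl,
    partSeries_nonOverWeight (mem_Ioc.1 hm).1, mul_assoc]
  congr 2
  exact prod_congr rfl fun i hi => by rw [if_neg (ne_of_mem_erase hi), factor]

/-- The generating function of the overpartitions with parts at most `N` whose smallest part
larger than `k` exists and appears at least `k + 1` times. -/
noncomputable def MSeries (N k : ℕ) : PowerSeries ℂ :=
  ∑ m ∈ Ioc k N, series k * (2 * X ^ (m * (k + 1)) * geom m) * ∏ i ∈ Ioc m N, factor i

/-- Sizes up to `k` or above `m` are free, those strictly between are absent, and `m` occurs at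
least `k + 1` times. -/
theorem prod_partSeries_ite {N k m : ℕ} (hm : m ∈ Ioc k N) :
    ∏ i ∈ Ioc 0 N, partSeries (fun c =>
        if (k < i → i < m → c = 0) ∧ (i = m → k + 1 ≤ c) then overWeight c else 0) i =
      series k * (2 * X ^ (m * (k + 1)) * geom m) * ∏ i ∈ Ioc m N, factor i := by
  obtain ⟨hkm, hmN⟩ := mem_Ioc.1 hm
  rw [← prod_Ioc_consecutive _ (Nat.zero_le m) hmN,
    ← prod_Ioc_consecutive _ (Nat.zero_le k) hkm.le]
  congr 1
  · congr 1
    · refine prod_congr rfl fun i hi => ?_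
      have := mem_Ioc.1 hi
      simp [show ¬ k < i by omega, show i ≠ m by omega, factor]
    · obtain ⟨m, rfl⟩ := Nat.exists_eq_add_of_lt hkm
      rw [prod_Ioc_succ_top (by omega), prod_eq_one, one_mul,
        ← partSeries_ite_le (by omega)]
      · simp
      · intro i hi
        have := mem_Ioc.1 hi
        rw [← partSeries_ite_eq_zero (show 0 < i by omega)]
        simp [show k < i by omega, show i < k + m + 1 by omega, show i ≠ k + m + 1 by omega]
  · refine prod_congr rfl fun i hi => ?_
    have := mem_Ioc.1 hi
    simp [show ¬ i < m by omega, show i ≠ m by omega, factor]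

theorem M_eq_coeff {n N k : ℕ} (hn : n ≤ N) : (M k n : ℂ) = coeff n (MSeries N k) := by
  classical
  -- `Q p m` says that `m` is the distinguished part in `P p`, as a conjunction of conditions on
  -- single multiplicities, so that its indicator is a product over sizes. At most one `m` satisfies
  -- it.
  let Q : Nat.Partition n → ℕ → Prop := fun p m =>
    ∀ i ∈ Ioc 0 N, (k < i → i < m → p.parts.count i = 0) ∧ (i = m → k + 1 ≤ p.parts.count i)
  let P : Nat.Partition n → Prop := fun p =>
    ∃ m ∈ p.parts.toFinset, k < m ∧ (∀ i ∈ p.parts.toFinset, k < i → m ≤ i) ∧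
      k + 1 ≤ p.parts.count m
  have hPQ : ∀ p, P p ↔ ∃ m ∈ Ioc k N, Q p m := by
    intro p
    constructor
    · rintro ⟨m, hm, hkm, hmin, hc⟩
      rw [Multiset.mem_toFinset] at hm
      refine ⟨m, mem_Ioc.2 ⟨hkm, (p.le_of_mem_parts hm).trans hn⟩, fun i _ => ⟨fun h1 h2 => ?_, ?_⟩⟩
      · refine Multiset.count_eq_zero.2 fun h => ?_
        have := hmin i (Multiset.mem_toFinset.2 h) h1
        omega
      · rintro rfl
        exact hc
    · rintro ⟨m, hm, hQ⟩
      obtain ⟨hkm, hmN⟩ := mem_Ioc.1 hm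
      have hc := (hQ m (mem_Ioc.2 ⟨by omega, hmN⟩)).2 rfl
      refine ⟨m, ?_, hkm, fun i hi hki => ?_, hc⟩
      · rw [Multiset.mem_toFinset, ← Multiset.one_le_count_iff_mem]
        omega
      · rw [Multiset.mem_toFinset] at hi
        by_contra h
        exact Multiset.count_ne_zero.2 hi
          ((hQ i (mem_Ioc.2 ⟨p.parts_pos hi, (p.le_of_mem_parts hi).trans hn⟩)).1 hki (by omega))
  have huniq : ∀ p m m', m ∈ Ioc k N → m' ∈ Ioc k N → Q p m → Q p m' → m' ≤ m := by
    intro p m m' hm hm' h h'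
    obtain ⟨hkm, hmN⟩ := mem_Ioc.1 hm
    have hm0 : m ∈ Ioc 0 N := mem_Ioc.2 ⟨by omega, hmN⟩
    by_contra hlt
    have h1 := (h m hm0).2 rfl
    have h2 := (h' m hm0).1 hkm (by omega)
    omega
  have h1 : (M k n : ℂ) = ∑ π : Overpartition n, if P π.toPartition then 1 else 0 := by
    rw [M, card_filter]
    push_cast
    exact sum_congr rfl fun π _ => if_congr Iff.rfl rfl rfl
  have h2 : ∀ p : Nat.Partition n,
      ∑ s ∈ p.parts.toFinset.powerset, (if P p then (1 : ℂ) else 0) =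
      ∑ m ∈ Ioc k N, ∏ i ∈ Ioc 0 N,
        if (k < i → i < m → p.parts.count i = 0) ∧ (i = m → k + 1 ≤ p.parts.count i)
          then overWeight (p.parts.count i) else 0 := by
    intro p
    simp only [prod_ite_zero, prod_overWeight hn]
    rw [sum_const, card_powerset, nsmul_eq_mul]
    by_cases hp : P p
    · obtain ⟨m, hm, hQ⟩ := (hPQ p).1 hp
      rw [sum_eq_single_of_mem m hm fun m' hm' hne => if_neg fun hQ' => hne
        (le_antisymm (huniq p m m' hm hm' hQ hQ') (huniq p m' m hm' hm hQ' hQ)),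
        if_pos hp, if_pos hQ]
      simp
    · rw [if_neg hp, sum_eq_zero fun m hm => if_neg fun hQ => hp ((hPQ p).2 ⟨m, hm, hQ⟩)]
      simp
  rw [h1, sum_eq_sum_partition fun p _ => if P p then (1 : ℂ) else 0,
    sum_congr rfl fun p _ => h2 p, sum_comm, MSeries, map_sum]
  refine sum_congr rfl fun m hm => ?_
  rw [← prod_partSeries_ite hm]
  exact sum_partition_prod_eq_coeff (fun i c =>
    if (k < i → i < m → c = 0) ∧ (i = m → k + 1 ≤ c) then overWeight c else 0) hn

/-! ### The truncated theta identity -/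

theorem sum_Ioc_telescope (U : ℕ → PowerSeries ℂ) {k N : ℕ} (h : k ≤ N) :
    ∑ m ∈ Ioc k N, (U (m - 1) - U m) = U k - U N := by
  induction N, h using Nat.le_induction with
  | base => simp
  | succ N hN ih =>
    rw [sum_Ioc_succ_top (by omega), ih]
    simp

theorem prod_Ioc_pred {m N : ℕ} (h0 : 0 < m) (h : m ≤ N) :
    ∏ i ∈ Ioc (m - 1) N, factor i = factor m * ∏ i ∈ Ioc m N, factor i := by
  rw [← prod_Ioc_consecutive _ (Nat.sub_le m 1) h]
  congr 1
  obtain ⟨m, rfl⟩ := Nat.exists_eq_add_of_lt h0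
  simp

theorem series_eq_one_add_MSeries (N : ℕ) : series N = 1 + MSeries N 0 := by
  have h := sum_Ioc_telescope (fun m => ∏ i ∈ Ioc m N, factor i) (Nat.zero_le N)
  have h' : MSeries N 0 =
      ∑ m ∈ Ioc 0 N, (∏ i ∈ Ioc (m - 1) N, factor i - ∏ i ∈ Ioc m N, factor i) := by
    refine sum_congr rfl fun m hm => ?_
    obtain ⟨h0, hm⟩ := mem_Ioc.1 hm
    rw [prod_Ioc_pred h0 hm, factor_eq_geom h0]
    simp only [series, Ioc_self, prod_empty, zero_add, mul_one, one_mul]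
    linear_combination (-∏ i ∈ Ioc m N, factor i) * geom_eq h0
  rw [h', h]
  simp [series]

/-- For `m > k + 1` the two `m`-th summands add up to `2 * series k * geom (k + 1)` times a
difference of consecutive values of `X^((k+1)(m+1)) * R m`. The lower end of the telescope joins the
term `m = k + 1` of `MSeries N k` to rebuild `series N`; the upper end is the error. -/
theorem MSeries_succ_add {N k : ℕ} (hk : k + 1 ≤ N) :
    MSeries N (k + 1) + MSeries N k =
      2 * X ^ ((k + 1) ^ 2) * series N - 2 * series k * geom (k + 1) * X ^ ((k + 1) * (N + 1)) := by
  set R : ℕ → PowerSeries ℂ := fun m => ∏ i ∈ Ioc m N, factor i with hR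
  have hser : ∀ j ≤ N, series N = series j * R j := fun j hj =>
    (prod_Ioc_consecutive _ (Nat.zero_le j) hj).symm
  have hsucc : series (k + 1) = series k * factor (k + 1) :=
    prod_Ioc_succ_top (Nat.zero_le k) _
  have hfac := factor_eq_geom (Nat.succ_pos k)
  have hgeom := geom_eq (Nat.succ_pos k)
  have htel := sum_Ioc_telescope (fun m => X ^ ((k + 1) * (m + 1)) * R m) hk
  have hsum : MSeries N (k + 1) + ∑ m ∈ Ioc (k + 1) N,
        series k * (2 * X ^ (m * (k + 1)) * geom m) * R m =
      2 * series k * geom (k + 1) * ∑ m ∈ Ioc (k + 1) N,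
        (X ^ ((k + 1) * (m - 1 + 1)) * R (m - 1) - X ^ ((k + 1) * (m + 1)) * R m) := by
    rw [MSeries, ← sum_add_distrib, mul_sum]
    refine sum_congr rfl fun m hm => ?_
    obtain ⟨h0, hm⟩ := mem_Ioc.1 hm
    have h0' : 0 < m := by omega
    have hRm : R (m - 1) = factor m * R m := prod_Ioc_pred h0' hm
    have hRm' : ∏ i ∈ Ioc m N, factor i = R m := rfl
    rw [hRm, hRm', hsucc, Nat.sub_add_cancel h0', factor_eq_geom h0', hfac]
    have hgm := geom_eq h0'
    simp only [Nat.succ_eq_add_one] at hgeom ⊢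
    linear_combination (-2 * series k * X ^ ((k + 1) * m) * R m * geom m) * hgeom
      - (2 * series k * geom (k + 1) * X ^ ((k + 1) * m) * X ^ (k + 1) * R m) * hgm
  have hsplit : MSeries N k = series k * (2 * X ^ ((k + 1) * (k + 1)) * geom (k + 1)) * R (k + 1) +
      ∑ m ∈ Ioc (k + 1) N, series k * (2 * X ^ (m * (k + 1)) * geom m) * R m := by
    rw [MSeries, ← sum_Ioc_consecutive _ (Nat.le_succ k) hk]
    simp [hR]
  have hRN : R N = 1 := by simp [hR]
  rw [hsplit, add_left_comm, hsum, htel, hser (k + 1) hk, hsucc, hfac, hRN]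
  simp only [Nat.succ_eq_add_one] at hgeom ⊢
  rw [show (k + 1) * (k + 1 + 1) = (k + 1) * (k + 1) + (k + 1) by ring, pow_add, sq (k + 1)]
  ring

theorem series_mul_truncated_theta {N k : ℕ} (hk : k ≤ N) :
    ∃ Y : PowerSeries ℂ,
      series N * (1 + 2 * ∑ j ∈ Icc 1 k, (-1) ^ j * X ^ (j ^ 2)) =
        1 + (-1) ^ k * MSeries N k + X ^ (N + 1) * Y := by
  induction k with
  | zero => exact ⟨0, by simp [series_eq_one_add_MSeries]⟩
  | succ k ih =>
    obtain ⟨Y, hY⟩ := ih (by omega)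
    have h := MSeries_succ_add hk
    -- The new error has exponent `(k + 1) * (N + 1)`, from which `X ^ (N + 1)` is factored out.
    refine ⟨Y + (-1) ^ (k + 1) * (2 * series k * geom (k + 1) * X ^ (k * (N + 1))), ?_⟩
    rw [sum_Icc_succ_top (by omega)]
    rw [show (k + 1) * (N + 1) = k * (N + 1) + (N + 1) by ring, pow_add] at h
    linear_combination hY - (-1) ^ (k + 1) * h

/-! ### Parts weighted by the characteristic function of the primes -/

/-- A series whose coefficients up to `N` are the numbers of distinct prime divisors. -/
noncomputable def primeSeries (N : ℕ) : PowerSeries ℂ :=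
  ∑ m ∈ range N, C (chi (m + 1)) * (X ^ (m + 1) * geom (m + 1))

theorem coeff_X_pow_mul_geom {m n : ℕ} (hm : 0 < m) (hn : 0 < n) :
    coeff n (X ^ m * geom m) = if m ∣ n then 1 else 0 := by
  have h : X ^ m * geom m = geom m - 1 := by linear_combination -geom_eq hm
  rw [h]
  simp [geom, partSeries, coeff_one, hn.ne']

theorem coeff_primeSeries {n N : ℕ} (hn : 0 < n) (hnN : n ≤ N) :
    coeff n (primeSeries N) = (ArithmeticFunction.cardDistinctFactors n : ℂ) := by
  have h : ArithmeticFunction.cardDistinctFactors n =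
      ((range N).filter fun m => (m + 1).Prime ∧ (m + 1) ∣ n).card := by
    rw [ArithmeticFunction.cardDistinctFactors_apply, ← List.card_toFinset]
    symm
    refine card_bij (fun m _ => m + 1) (fun m hm => ?_) (fun a _ b _ h => by simpa using h)
      fun p hp => ?_
    · rw [mem_filter] at hm
      exact Nat.mem_primeFactors.2 ⟨hm.2.1, hm.2.2, hn.ne'⟩
    · obtain ⟨hp, hpn, -⟩ := Nat.mem_primeFactors.1 hp
      have h0 := hp.pos
      have h1 := Nat.le_of_dvd hn hpn
      refine ⟨p - 1, mem_filter.2 ⟨mem_range.2 (by omega), ?_⟩, by omega⟩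
      rw [Nat.sub_add_cancel h0]
      exact ⟨hp, hpn⟩
  rw [h, card_filter, primeSeries, map_sum]
  push_cast
  refine sum_congr rfl fun m _ => ?_
  rw [coeff_C_mul, coeff_X_pow_mul_geom (Nat.succ_pos m) hn, chi]
  split_ifs <;> simp_all

theorem coeff_zero_primeSeries (N : ℕ) : coeff 0 (primeSeries N) = 0 := by
  simp [primeSeries]

theorem A_chi_natCast {n N : ℕ} (hn : n ≤ N) :
    A chi 1 0 n = coeff n (primeSeries N * series N) := by
  have h0 : (0 : ℤ) ≤ n := by positivity
  simp only [A, if_pos h0, Int.toNat_natCast, one_mul, Nat.sub_zero]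
  rw [tsum_eq_sum (s := range N) fun m hm => by
    rw [S_eq_zero (by rw [mem_range] at hm; omega)]; simp]
  rw [primeSeries, sum_mul, map_sum]
  refine sum_congr rfl fun m hm => ?_
  rw [S_eq_coeff hn (mem_Ioc.2 ⟨Nat.succ_pos m, mem_range.1 hm⟩), mul_assoc (C _), coeff_C_mul,
    mul_comm]

theorem A_chi_natCast_sub_sq {n N : ℕ} (hn : n ≤ N) (j : ℕ) :
    A chi 1 0 ((n : ℤ) - (j : ℤ) ^ 2) = coeff n (X ^ (j ^ 2) * (primeSeries N * series N)) := by
  rw [coeff_X_pow_mul']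
  split_ifs with h
  · rw [← A_chi_natCast ((Nat.sub_le n _).trans hn)]
    push_cast [h]
    rfl
  -- For `n < j ^ 2` the convention that `A` vanishes at negative arguments matches the zero
  -- coefficient.
  · rw [A, if_neg]
    push Not at h ⊢
    zify at h
    linarith

theorem coeff_primeSeries_mul_MSeries {n N k : ℕ} (hn : n ≤ N) :
    coeff n (primeSeries N * MSeries N k) =
      ∑ j ∈ Icc 2 n, (ArithmeticFunction.cardDistinctFactors j : ℂ) * (M k (n - j) : ℂ) := by
  rw [coeff_mul, Nat.sum_antidiagonal_eq_sum_range_succ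
    (fun i j => coeff i (primeSeries N) * coeff j (MSeries N k))]
  symm
  refine sum_subset_zero_on_sdiff (fun j hj => ?_) (fun j hj => ?_) fun j hj => ?_
  · rw [mem_Icc] at hj
    rw [mem_range]
    omega
  · rw [mem_sdiff, mem_range, mem_Icc] at hj
    -- The convolution may start at 2: the constant term of `primeSeries N` is zero, and 1 has no
    -- prime divisor.
    obtain rfl | rfl : j = 0 ∨ j = 1 := by omega
    · rw [coeff_zero_primeSeries, zero_mul]
    · rw [coeff_primeSeries one_pos (by omega)]
      simp
  · rw [mem_Icc] at hj
    rw [coeff_primeSeries (by omega) (by omega), M_eq_coeff ((Nat.sub_le n j).trans hn)]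

theorem truncated_theta_primes (k : ℕ) {n : ℕ} (hn : 0 < n) :
    (-1 : ℂ) ^ k * (A chi 1 0 (n : ℤ)
          + 2 * ∑ j ∈ Icc 1 k, (-1 : ℂ) ^ j * A chi 1 0 ((n : ℤ) - (j : ℤ) ^ 2)
          - (ArithmeticFunction.cardDistinctFactors n : ℂ)) =
      ∑ j ∈ Icc 2 n, (ArithmeticFunction.cardDistinctFactors j : ℂ) * (M k (n - j) : ℂ) := by
  -- The bound `N = n + k` serves both `n ≤ N`, for reading coefficients, and `k ≤ N`, for the
  -- truncated identity.
  have hN : n ≤ n + k := Nat.le_add_right n k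
  obtain ⟨Y, hY⟩ := series_mul_truncated_theta (Nat.le_add_left k n)
  have hsign : ∀ j : ℕ, (-1 : PowerSeries ℂ) ^ j = C ((-1 : ℂ) ^ j) := fun j => by simp
  have key : primeSeries (n + k) * series (n + k) +
      C 2 * ∑ j ∈ Icc 1 k,
        C ((-1 : ℂ) ^ j) * (X ^ (j ^ 2) * (primeSeries (n + k) * series (n + k))) =
      primeSeries (n + k) + C ((-1 : ℂ) ^ k) * (primeSeries (n + k) * MSeries (n + k) k) +
        X ^ (n + k + 1) * (primeSeries (n + k) * Y) := by
    have hs : ∑ j ∈ Icc 1 k,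
        C ((-1 : ℂ) ^ j) * (X ^ (j ^ 2) * (primeSeries (n + k) * series (n + k))) =
        (∑ j ∈ Icc 1 k, (-1) ^ j * X ^ (j ^ 2)) * (primeSeries (n + k) * series (n + k)) := by
      rw [sum_mul]
      exact sum_congr rfl fun j _ => by rw [hsign, mul_assoc]
    rw [hs, ← hsign, map_ofNat]
    linear_combination primeSeries (n + k) * hY
  have h := congrArg (coeff n) key
  rw [map_add, map_add, map_add, coeff_C_mul, coeff_C_mul, map_sum, coeff_X_pow_mul',
    if_neg (by omega), coeff_primeSeries hn hN, coeff_primeSeries_mul_MSeries hN,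
    ← A_chi_natCast hN, add_zero] at h
  simp only [coeff_C_mul, ← A_chi_natCast_sub_sq hN] at h
  have h1 : (-1 : ℂ) ^ k * (-1) ^ k = 1 := by rw [← mul_pow]; simp
  linear_combination (-1 : ℂ) ^ k * h + (∑ j ∈ Icc 2 n,
    (ArithmeticFunction.cardDistinctFactors j : ℂ) * (M k (n - j) : ℂ)) * h1

end Overpartition

theorem corollaryC4p2 (k n : ℕ) (hk : 0 < k) (hn : 0 < n) :
    (-1 : ℂ) ^ k *
        (Overpartition.A Overpartition.chi 1 0 (n : ℤ)
          + 2 * ∑ j ∈ Finset.Icc 1 k,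
              (-1 : ℂ) ^ j * Overpartition.A Overpartition.chi 1 0 ((n : ℤ) - (j : ℤ) ^ 2)
          - (ArithmeticFunction.cardDistinctFactors n : ℂ))
      = ∑ j ∈ Finset.Icc 2 n,
          (ArithmeticFunction.cardDistinctFactors j : ℂ) * (Overpartition.M k (n - j) : ℂ) :=
  Overpartition.truncated_theta_primes k hn
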